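/- **Stokes circles.** An exponential factor is a finite sum $q=\sum_{k} a_k z^{k}$ over rational exponents $k>0$, $a_k\in\mathbb C$. The Galois conjugates of $q$ are the sums $\sum_k a_k e^{2\pi i mk}z^k$, $m\in\mathbb Z$; the Galois orbit $I=\langle q\rangle$ is called a Stokes circle. Its set of exponents is $E(I)=\{k: a_k\neq 0\}$, and its ramification order $\mathrm{Ram}(I)$ is the least integer $r\ge1$ with $E(I)\subset\frac1r\mathbb Z$. The slope of $q$ is its largest exponent ($0$ if $q=0$). An irregular class is a finite multiset $\Theta=\sum_{i\in N} n_iI_i$ of Stokes circles ($n_i\geq 1$, $I_i$ pairwise distinct); it is untwisted if all $\mathrm{Ram}(I_i)=1$. Let $(E,\nabla)$ be an algebraic connection on the affine line $\mathbb A^1(\mathbb C)$ with coordinate $z$, written in a basis as $\nabla_{d/dz}=\frac{d}{dz}+A(z)$. Its irregular class $\Theta$ at infinity is the one given by the Turrittin–Levelt theorem: the system $Y'=-AY$ has a formal fundamental solution $P(t)\,t^{\Lambda}e^{\mathrm{diag}(q_1,\dots,q_n)}$ at $\infty$, where $z=t^{-R}$ for some integer $R\ge 1$, $P$ is an invertible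 matrix of formal Laurent series in $t$, the $q_a$ are exponential factors that are polynomials in $z^{1/R}$, and $\Lambda$ is a constant matrix commuting with $\mathrm{diag}(q_1,\dots,q_n)$; every exponential factor $q$ occurs among $q_1,\dots,q_n$ exactly as many times as $\langle q\rangle$ occurs in $\Theta$. **Multiplicities.** For a Stokes circle $I$ with $r=\mathrm{Ram}(I)$ and $E(I)=\{k_0>\dots>k_p\}$, $k_j=m_j/r$, put $$B_{I,I}=\sum_{j=0}^{p} m_j\bigl(\gcd(r,m_0,\dots,m_{j-1})-\gcd(r,m_0,\dots,m_j)\bigr)-r^2+1 .$$ Let $I=\langle q\rangle\ne J=\langle q'\rangle$ with ramification orders $r,r'$. Let $\tau_l(q)$ be the sum of the monomials of $q$ of exponent $\ge l$, let $k$ be the least $l\in\frac{1}{\mathrm{lcm}(r,r')}\mathbb Z_{>0}$ with $\langle\tau_l(q)\rangle=\langle\tau_l(q')\rangle$, and let $q_d=q-\tau_k(q)$, $q'_d=q'-\tau_k(q')$. Let $k_0>\dots>k_t$ be the exponents (if any) of $\langle\tau_k(q)\rangle$, $k_j=m_j/r=m'_j/r'$. If $\mathrm{Slope}(q_d)\ge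 \mathrm{Slope}(q'_d)$ and $\mathrm{Slope}(q_d)=s_d/r$, put $$B_{I,J}=B_{J,I}=\sum_{j=0}^{t} m_j\bigl(\gcd(r',m'_0,\dots,m'_{j-1})-\gcd(r',m'_0,\dots,m'_j)\bigr)+s_d\gcd(r',m'_0,\dots,m'_t)-rr'.$$ (In both formulas the first $\gcd$ in the term $j=0$ is $r$, respectively $r'$; if there are no exponents $k_j$, the sum is $0$ and the last $\gcd$ of the second formula is $r'$.) **Diagrams.** A diagram is a pair $(N,B)$ with $N$ a finite nonempty set and $B=(B_{ij})_{i,j\in N}$ a symmetric integer matrix with even diagonal entries ($B_{ij}$ is the number of edges between $i\ne j$, $B_{ii}/2$ the number of loops at $i$). It is a graph if $B_{ii}=0$ and $B_{ij}\ge 0$ for all $i,j$, and it is simply-laced if it is a graph with $B_{ij}\in\{0,1\}$ for all $i\neq j$. The core diagram $\Gamma_c(\Theta)$ of $\Theta=\sum_{i\in N} n_iI_i$ is $(N,(B_{I_i,I_j})_{i,j\in N})$. A diagram is a nonabelian Hodge diagram if (up to relabelling its vertices) it is $\Gamma_c(\Theta)$ for the irregular class $\Theta$ at infinity of an algebraic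 connection on the affine line, and a fission graph if it is so for a connection with untwisted $\Theta$. It is a complete $k$-partite graph if $N$ can be partitioned into $k$ nonempty parts such that $B_{ij}=0$ for $i,j$ in the same part (including $i=j$) and $B_{ij}=1$ for $i,j$ in different parts. **Proposition 4.5 (also Theorem 1.5).** Every simply-laced nonabelian Hodge diagram is a simply-laced fission graph, and is a complete $k$-partite graph for some integer $k\ge1$. Moreover, the simply-laced fission graphs are exactly the diagrams that are complete $k$-partite graphs for some integer $k\geq 1$. -/

import Mathlib

open scoped Polynomial LaurentSeries

noncomputable section

/-! ### Diagrams and graphs -/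

/-- A diagram on a (finite) vertex set `N`: a symmetric integer matrix with even diagonal.
`B i j` is the number of edges between distinct `i`, `j`, and `B i i / 2` the number of loops. -/
structure Diagram (N : Type*) where
  B : Matrix N N ℤ
  symm : ∀ i j, B i j = B j i
  even_diag : ∀ i, Even (B i i)

namespace Diagram

variable {N : Type*}

/-- A graph is a diagram without loops nor negative edges. -/
def IsGraph (Γ : Diagram N) : Prop :=
  (∀ i j, 0 ≤ Γ.B i j) ∧ ∀ i, Γ.B i i = 0

/-- A simply-laced diagram is a graph (in particular it has no loops)
whose edge multiplicities are all `0` or `1`. -/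
def IsSimplyLaced (Γ : Diagram N) : Prop :=
  Γ.IsGraph ∧ ∀ i j, i ≠ j → Γ.B i j = 0 ∨ Γ.B i j = 1

/-- Complete `k`-partite graphs: the vertices are partitioned into `k` nonempty parts, there is
no edge inside a part, and exactly one edge between any two vertices in different parts. -/
def IsCompletePartite (Γ : Diagram N) (k : ℕ) : Prop :=
  ∃ f : N → Fin k, Function.Surjective f ∧
    (∀ i j, f i = f j → Γ.B i j = 0) ∧ (∀ i j, f i ≠ f j → Γ.B i j = 1)

end Diagram

/-! ### Exponential factors and Stokes circles at infinity -/

/-- An exponential factor `q = ∑ a_k z ^ k`: a finite sum over positive rational exponents `k`,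
i.e. a polynomial without constant term in some root `z ^ (1 / r)`. -/
@[ext]
structure ExpFactor where
  coeff : ℚ →₀ ℂ
  pos : ∀ k ∈ coeff.support, 0 < k

namespace ExpFactor

/-- The set of exponents of `q`. -/
def exponents (q : ExpFactor) : Finset ℚ := q.coeff.support

/-- The ramification order: the least `r ≥ 1` such that all exponents of `q` lie in `(1 / r) ℤ`
(see `isLeast_ram`). -/
def ram (q : ExpFactor) : ℕ := q.exponents.lcm Rat.den

theorem isLeast_ram (q : ExpFactor) :
    IsLeast {r : ℕ | 1 ≤ r ∧ ∀ k ∈ q.exponents, ∃ j : ℕ, k = (j : ℚ) / r} q.ram := by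
  have hne : q.ram ≠ 0 := by
    intro h
    rw [ram, Finset.lcm_eq_zero_iff] at h
    obtain ⟨k, -, hk⟩ := h
    exact k.den_ne_zero hk
  refine ⟨⟨Nat.one_le_iff_ne_zero.mpr hne, fun k hk => ?_⟩, ?_⟩
  · obtain ⟨c, hc⟩ : k.den ∣ q.ram := Finset.dvd_lcm hk
    have hc0 : c ≠ 0 := by
      rintro rfl
      exact hne (by simpa using hc)
    have hk0 : 0 < k := q.pos k hk
    refine ⟨k.num.natAbs * c, ?_⟩
    have h1 : (((k.num.natAbs : ℕ) : ℤ) : ℚ) = k.num := by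
      have h2 : ((k.num.natAbs : ℕ) : ℤ) = k.num :=
        Int.natAbs_of_nonneg (Rat.num_pos.mpr hk0).le
      exact congrArg (Int.cast : ℤ → ℚ) h2
    have hd : (k.den : ℚ) ≠ 0 := by exact_mod_cast k.den_ne_zero
    have hc' : (c : ℚ) ≠ 0 := by exact_mod_cast hc0
    rw [hc]
    rw [Nat.cast_mul, Nat.cast_mul, ← Int.cast_natCast k.num.natAbs, h1, mul_div_mul_right _ _ hc', Rat.num_div_den]
  · rintro r ⟨hr, h⟩
    refine Nat.le_of_dvd hr (Finset.lcm_dvd fun k hk => ?_)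
    obtain ⟨j, rfl⟩ := h k hk
    have h2 := Rat.den_dvd (j : ℤ) (r : ℤ)
    have h3 : (Rat.divInt (j : ℤ) (r : ℤ)) = (j : ℚ) / r := by
      rw [Rat.divInt_eq_div]; simp
    rw [h3] at h2
    exact_mod_cast h2

/-- Galois conjugation: `q` and `q'` are conjugate if `q'` is obtained from `q` by turning `m` times
around infinity for some integer `m`, i.e. by replacing `z ^ k` with `exp (2 π i m k) z ^ k`. -/
instance setoid : Setoid ExpFactor where
  r q q' := ∃ m : ℤ, ∀ k : ℚ,
    q'.coeff k = Complex.exp (2 * Real.pi * Complex.I * m * k) * q.coeff k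
  iseqv :=
    { refl := fun q => ⟨0, fun k => by simp⟩
      symm := by
        rintro q q' ⟨m, h⟩
        refine ⟨-m, fun k => ?_⟩
        rw [h k, ← mul_assoc, ← Complex.exp_add]
        have : 2 * Real.pi * Complex.I * ((-m : ℤ) : ℂ) * k
            + 2 * Real.pi * Complex.I * (m : ℂ) * k = 0 := by
          push_cast; ring
        rw [this, Complex.exp_zero, one_mul]
      trans := by
        rintro q q' q'' ⟨m, h⟩ ⟨m', h'⟩
        refine ⟨m' + m, fun k => ?_⟩
        rw [h' k, h k, ← mul_assoc, ← Complex.exp_add]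
        congr 2
        push_cast
        ring }

theorem exponents_eq_of_equiv {q q' : ExpFactor} (h : q ≈ q') : q.exponents = q'.exponents := by
  obtain ⟨m, h⟩ := h
  ext k
  simp [exponents, h k]

/-- The truncation `τ_l (q)`: all monomials of exponent `< l` are removed. -/
def trunc (l : ℚ) (q : ExpFactor) : ExpFactor where
  coeff := q.coeff.filter (fun k => l ≤ k)
  pos k hk := q.pos k (by
    rw [Finsupp.support_filter] at hk
    exact (Finset.mem_filter.mp hk).1)

theorem trunc_equiv (l : ℚ) {q q' : ExpFactor} (h : q ≈ q') : q.trunc l ≈ q'.trunc l := by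
  obtain ⟨m, h⟩ := h
  refine ⟨m, fun k => ?_⟩
  by_cases hk : l ≤ k <;> simp [trunc, hk, h k]

/-- The pullback of `q` to the cover `z = t ^ (-R)` (where `ram q ∣ R`), as a Laurent series in `t`:
the monomial `z ^ k` becomes `t ^ (- R k)`. -/
def toLaurent (R : ℕ) (q : ExpFactor) : ℂ⸨X⸩ :=
  ∑ k ∈ q.exponents, HahnSeries.single (-((R : ℚ) * k).num) (q.coeff k)

end ExpFactor

/-- A Stokes circle (at infinity): the Galois orbit of an exponential factor. -/
def StokesCircle : Type := Quotient ExpFactor.setoid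

/-- The Stokes circle `⟨q⟩` of an exponential factor `q`. -/
def ExpFactor.circle (q : ExpFactor) : StokesCircle := Quotient.mk ExpFactor.setoid q

namespace StokesCircle

/-- The set of exponents `E(I)` of a Stokes circle. -/
def exponents (I : StokesCircle) : Finset ℚ :=
  Quotient.lift ExpFactor.exponents (fun _ _ h => ExpFactor.exponents_eq_of_equiv h) I

/-- The ramification order of a Stokes circle. -/
def ram (I : StokesCircle) : ℕ :=
  Quotient.lift ExpFactor.ram
    (fun _ _ h => by simp only [ExpFactor.ram, ExpFactor.exponents_eq_of_equiv h]) I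

/-- The truncation `⟨τ_l (q)⟩` of a Stokes circle `⟨q⟩`. -/
def trunc (l : ℚ) (I : StokesCircle) : StokesCircle :=
  Quotient.map (ExpFactor.trunc l) (fun _ _ h => ExpFactor.trunc_equiv l h) I

/-- For `k ∈ E(I)` and any multiple `r` of the denominator of `k`, the integer `m = r k`,
so that `k = m / r`. -/
def numer (r : ℕ) (k : ℚ) : ℕ := ((r : ℚ) * k).num.natAbs

/-- `gcd (r, m_k : k ∈ S)`, where `k = m_k / r`; it is `r` when `S` is empty. -/
def gcdOf (r : ℕ) (S : Finset ℚ) : ℕ := Nat.gcd r (S.gcd (numer r))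

/-- The loop multiplicity
`B_{I,I} = ∑_j m_j (gcd (r, m_0, …, m_{j-1}) - gcd (r, m_0, …, m_j)) - r ^ 2 + 1`,
the sum being over all exponents `k_0 > ⋯ > k_p` of `I`, `k_j = m_j / r`. -/
def loopMult (I : StokesCircle) : ℤ :=
  ∑ k ∈ I.exponents, (numer I.ram k : ℤ) *
      ((gcdOf I.ram (I.exponents.filter (fun l => k < l)) : ℤ)
        - (gcdOf I.ram (I.exponents.filter (fun l => k ≤ l)) : ℤ))
    - (I.ram : ℤ) ^ 2 + 1

/-- For distinct circles `⟨q⟩`, `⟨q'⟩`, the smallest `l` in `(1 / lcm (r, r')) ℤ_{>0}` such that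
`⟨τ_l (q)⟩ = ⟨τ_l (q')⟩`. -/
def commonThreshold (I J : StokesCircle) : ℚ :=
  (sInf {n : ℕ | 0 < n ∧
      I.trunc ((n : ℚ) / (Nat.lcm I.ram J.ram : ℕ)) = J.trunc ((n : ℚ) / (Nat.lcm I.ram J.ram : ℕ))} : ℕ)
    / (Nat.lcm I.ram J.ram : ℕ)

/-- The common part `⟨q_c⟩ = ⟨q'_c⟩` of two circles. -/
def commonPart (I J : StokesCircle) : StokesCircle := I.trunc (commonThreshold I J)

/-- The slope of the different part `q_d = q - q_c` of `q` with respect to `q'`, where `I = ⟨q⟩`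
and `J = ⟨q'⟩`: its largest exponent (and `0` if `q_d = 0`). -/
def diffSlope (I J : StokesCircle) : ℚ :=
  (insert 0 (I.exponents.filter (fun k => k < commonThreshold I J))).max'
    (Finset.insert_nonempty _ _)

/-- The expression for the edge multiplicity when `Slope (q_d) ≥ Slope (q'_d)`:
`∑_j m_j (gcd (r', m'_0, …, m'_{j-1}) - gcd (r', m'_0, …, m'_j)) + s_d gcd (r', m'_0, …, m'_t) - r r'`
where `k_0 > ⋯ > k_t` are the exponents of the common part, `k_j = m_j / r = m'_j / r'`, and
`Slope (q_d) = s_d / r`. -/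
def edgeFormula (I J : StokesCircle) : ℤ :=
  ∑ k ∈ (commonPart I J).exponents, (numer I.ram k : ℤ) *
      ((gcdOf J.ram ((commonPart I J).exponents.filter (fun l => k < l)) : ℤ)
        - (gcdOf J.ram ((commonPart I J).exponents.filter (fun l => k ≤ l)) : ℤ))
    + (numer I.ram (diffSlope I J) : ℤ) * (gcdOf J.ram (commonPart I J).exponents : ℤ)
    - (I.ram : ℤ) * (J.ram : ℤ)

/-- The edge multiplicity `B_{I,J}` of two distinct Stokes circles. -/
def edgeMult (I J : StokesCircle) : ℤ :=
  if diffSlope J I ≤ diffSlope I J then edgeFormula I J else edgeFormula J I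

end StokesCircle

/-! ### Irregular classes and their core diagrams -/

/-- An irregular class at infinity: a finite multiset `∑ n_I I` of Stokes circles. -/
abbrev IrregularClass : Type := StokesCircle →₀ ℕ

/-- Untwisted irregular classes: all Stokes circles have ramification order `1`. -/
def IrregularClass.IsUntwisted (Θ : IrregularClass) : Prop := ∀ I ∈ Θ.support, I.ram = 1

/-- `Γ` is (up to a labelling of its vertices) the core diagram `Γ_c(Θ)`: its vertices are the
distinct Stokes circles of `Θ`, and its multiplicities are those of the circles. -/
def Diagram.IsCoreDiagramOf {N : Type*} (Γ : Diagram N) (Θ : IrregularClass) : Prop :=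
  ∃ e : N ≃ {I : StokesCircle // I ∈ Θ.support},
    (∀ i, Γ.B i i = StokesCircle.loopMult (e i).1) ∧
    (∀ i j, i ≠ j → Γ.B i j = StokesCircle.edgeMult (e i).1 (e j).1)

/-! ### Algebraic connections on the affine line -/

/-- An algebraic connection on the affine line: a vector bundle, i.e. a finitely generated
projective `ℂ[z]`-module `E`, with an additive operator `∇ = ∇_{d/dz}` satisfying the Leibniz rule
(which implies `ℂ`-linearity). -/
structure AlgConnection where
  E : Type
  [addCommGroup : AddCommGroup E]
  [module : Module ℂ[X] E]
  [finite : Module.Finite ℂ[X] E]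
  [projective : Module.Projective ℂ[X] E]
  nabla : E →+ E
  leibniz : ∀ (f : ℂ[X]) (s : E), nabla (f • s) = Polynomial.derivative f • s + f • nabla s

attribute [instance] AlgConnection.addCommGroup AlgConnection.module AlgConnection.finite
  AlgConnection.projective

namespace AlgConnection

/-- The connection matrix `A` in a basis `b`: `∇ b_j = ∑ i, A i j • b_i`, so that `∇ = d/dz + A`
in this basis, and horizontal sections are the solutions of `dY/dz = - A Y`. -/
def connMatrix (V : AlgConnection) {n : ℕ} (b : Module.Basis (Fin n) ℂ[X] V.E) :
    Matrix (Fin n) (Fin n) ℂ[X] :=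
  fun i j => b.repr (V.nabla (b j)) i

end AlgConnection

/-- The Euler derivation `t d/dt` on Laurent series in `t`. -/
def eulerD (f : ℂ⸨X⸩) : ℂ⸨X⸩ := HahnSeries.single (1 : ℤ) (1 : ℂ) * LaurentSeries.derivative ℂ f

/-- The system `dY/dz = - A Y` has, near infinity, the formal fundamental solution
`Y = P(t) t ^ Λ exp (diag (q_1, …, q_n))` with `z = t ^ (-R)`, where `P` is an invertible matrix of
formal Laurent series in `t`, `q_1, …, q_n` are exponential factors in `z ^ (1 / R)`, and `Λ` is a
constant matrix commuting with `diag (q_1, …, q_n)`.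
Since `t d/dt = - R z d/dz`, the equation reads
`t dP/dt + P (Λ + diag (t dq_a/dt)) = R z A(z) P` with `z = t ^ (-R)`. -/
structure IsFormalSolution {n : ℕ} (A : Matrix (Fin n) (Fin n) ℂ[X]) (R : ℕ)
    (P : Matrix (Fin n) (Fin n) ℂ⸨X⸩) (Λ : Matrix (Fin n) (Fin n) ℂ)
    (q : Fin n → ExpFactor) : Prop where
  pos : 0 < R
  ram_dvd : ∀ a, (q a).ram ∣ R
  isUnit : IsUnit P
  commute : ∀ a c, q a ≠ q c → Λ a c = 0
  eqn : P.map eulerD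
      + P * (Λ.map HahnSeries.C + Matrix.diagonal (fun a => eulerD ((q a).toLaurent R)))
    = (HahnSeries.single (-(R : ℤ)) (R : ℂ)) •
        (A.map (Polynomial.aeval (HahnSeries.single (-(R : ℤ)) (1 : ℂ) : ℂ⸨X⸩)) * P)

/-- `Θ` is the irregular class at infinity of the connection `V`: for a formal fundamental solution
at infinity as in the Turrittin–Levelt theorem, each exponential factor `q` occurs
with the multiplicity `Θ ⟨q⟩` of its Stokes circle in `Θ`. -/
def AlgConnection.HasIrregularClass (V : AlgConnection) (Θ : IrregularClass) : Prop :=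
  ∃ (n : ℕ) (b : Module.Basis (Fin n) ℂ[X] V.E) (R : ℕ) (P : Matrix (Fin n) (Fin n) ℂ⸨X⸩)
    (Λ : Matrix (Fin n) (Fin n) ℂ) (q : Fin n → ExpFactor),
    IsFormalSolution (V.connMatrix b) R P Λ q ∧
    ∀ p : ExpFactor, Nat.card {a : Fin n // q a = p} = Θ p.circle

/-! ### Nonabelian Hodge diagrams and fission graphs -/

namespace Diagram

variable {N : Type*}

/-- A nonabelian Hodge diagram is the core diagram of an algebraic connection on the
affine line. -/
def IsNonabelianHodge (Γ : Diagram N) : Prop :=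
  ∃ (V : AlgConnection) (Θ : IrregularClass), V.HasIrregularClass Θ ∧ Γ.IsCoreDiagramOf Θ

/-- A fission graph is the core diagram of an algebraic connection on the affine line with
untwisted irregular class at infinity. -/
def IsFissionGraph (Γ : Diagram N) : Prop :=
  ∃ (V : AlgConnection) (Θ : IrregularClass),
    V.HasIrregularClass Θ ∧ Θ.IsUntwisted ∧ Γ.IsCoreDiagramOf Θ

end Diagram

end

/-!
Let `δ` be the largest exponent at which two Stokes circles `I`, `J` differ. Then
`B_{I,J} = r r' (M_J(δ) - 1)`, where `M_J(δ)` is the mean of `max δ (slope (q - q'))` over the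
Galois conjugates `q'` of a representative `q` of `J`. The function `M_J` is monotone,
`M_I(δ) = M_J(δ)`, and the exponents `δ` satisfy the ultrametric inequality, so `B_{I,J} ≤ 0` is a
transitive relation on Stokes circles. In a simply-laced core diagram non-adjacency is therefore
an equivalence relation, i.e. the diagram is complete multipartite.

Conversely, for distinct untwisted circles `B_{I,J} = δ - 1`, so the complete multipartite graph
with parts `f i` is the core diagram of the circles `⟨f(i) z² + b_i z⟩` with distinct `b_i`, and
`d/dz - diag (q_i')` has the fundamental solution `exp (diag (q_i))`.
-/

noncomputable section

namespace StokesCircle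

/-- The reciprocal of the ramification order of an exponential factor with set of exponents `S`.
When `S` is a set of exponents of `q`, it is the proportion of the Galois conjugates of `q` that
have the same monomials as `q` at the exponents in `S`. -/
def invRam (S : Finset ℚ) : ℚ := ((S.lcm Rat.den : ℕ) : ℚ)⁻¹

theorem lcm_den_pos (S : Finset ℚ) : 0 < S.lcm Rat.den := by
  rw [Nat.pos_iff_ne_zero, Ne, Finset.lcm_eq_zero_iff]
  rintro ⟨k, -, hk⟩
  exact k.den_ne_zero hk

theorem invRam_nonneg (S : Finset ℚ) : 0 ≤ invRam S := by
  unfold invRam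
  positivity

theorem invRam_anti {S T : Finset ℚ} (h : S ⊆ T) : invRam T ≤ invRam S := by
  have hle : S.lcm Rat.den ≤ T.lcm Rat.den := Nat.le_of_dvd (lcm_den_pos T) (Finset.lcm_mono h)
  have hpos : (0 : ℚ) < (S.lcm Rat.den : ℕ) := by exact_mod_cast lcm_den_pos S
  unfold invRam
  gcongr

theorem numer_den_mul (k : ℚ) (c : ℕ) : numer (k.den * c) k = k.num.natAbs * c := by
  have h : ((k.den * c : ℕ) : ℚ) * k = ((k.num * c : ℤ) : ℚ) := by
    push_cast
    rw [mul_right_comm, Rat.den_mul_eq_num]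
  rw [numer, h, Rat.num_intCast, Int.natAbs_mul, Int.natAbs_natCast]

theorem cast_numer {r : ℕ} {k : ℚ} (hk : 0 ≤ k) (hd : k.den ∣ r) : (numer r k : ℚ) = r * k := by
  obtain ⟨c, rfl⟩ := hd
  have hnum : (k.num.natAbs : ℚ) = k.num := by
    rw [Nat.cast_natAbs, abs_of_nonneg (Rat.num_nonneg.mpr hk)]
  rw [numer_den_mul, Nat.cast_mul, Nat.cast_mul, hnum, mul_right_comm, Rat.den_mul_eq_num]

theorem dvd_numer_iff {x y : ℕ} {k : ℚ} (hxy : x * y ≠ 0) (hd : k.den ∣ x * y) :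
    x ∣ numer (x * y) k ↔ k.den ∣ y := by
  obtain ⟨c, hc⟩ := hd
  have hy : 0 < y := Nat.pos_of_ne_zero (right_ne_zero_of_mul hxy)
  have hc0 : 0 < c := Nat.pos_of_ne_zero (right_ne_zero_of_mul (hc ▸ hxy))
  calc x ∣ numer (x * y) k
      ↔ x * y ∣ k.num.natAbs * c * y := by
        rw [hc, numer_den_mul, ← hc, Nat.mul_dvd_mul_iff_right hy]
    _ ↔ k.den * c ∣ k.num.natAbs * y * c := by rw [hc, mul_right_comm]
    _ ↔ k.den ∣ k.num.natAbs * y := Nat.mul_dvd_mul_iff_right hc0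
    _ ↔ k.den ∣ y := k.reduced.symm.dvd_mul_left

theorem gcdOf_mul_lcm_den {r : ℕ} (hr : r ≠ 0) {S : Finset ℚ} (hS : ∀ k ∈ S, k.den ∣ r) :
    gcdOf r S * S.lcm Rat.den = r := by
  have dvd_gcdOf_iff : ∀ x y : ℕ, r = x * y → (x ∣ gcdOf r S ↔ S.lcm Rat.den ∣ y) := by
    rintro x y rfl
    rw [gcdOf, Nat.dvd_gcd_iff, Finset.dvd_gcd_iff, Finset.lcm_dvd_iff,
      and_iff_right (dvd_mul_right x y)]
    exact forall₂_congr fun k hk => dvd_numer_iff hr (hS k hk)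
  obtain ⟨c, hc⟩ : S.lcm Rat.den ∣ r := Finset.lcm_dvd hS
  obtain ⟨y, hy⟩ : gcdOf r S ∣ r := Nat.gcd_dvd_left _ _
  refine Nat.dvd_antisymm ?_ ?_
  · exact (mul_dvd_mul_left _ ((dvd_gcdOf_iff _ y hy).1 dvd_rfl)).trans hy.symm.dvd
  · rw [mul_comm] at hc
    exact hc.dvd.trans (mul_dvd_mul_right ((dvd_gcdOf_iff c _ hc).2 dvd_rfl) _)

theorem cast_gcdOf {r : ℕ} (hr : r ≠ 0) {S : Finset ℚ} (hS : ∀ k ∈ S, k.den ∣ r) :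
    (gcdOf r S : ℚ) = r * invRam S := by
  have hne : ((S.lcm Rat.den : ℕ) : ℚ) ≠ 0 := by exact_mod_cast (lcm_den_pos S).ne'
  rw [invRam, eq_mul_inv_iff_mul_eq₀ hne]
  exact_mod_cast gcdOf_mul_lcm_den hr hS

/-- The mean of `max δ (slope (q - q'))` over the Galois conjugates `q'` of an exponential factor
`q` with set of exponents `E`: the difference `q - q'` has slope `k ∈ E` for a proportion
`invRam E_{>k} - invRam E_{≥k}` of them, and vanishes for a proportion `invRam E`. -/
def meanSlope (E : Finset ℚ) (δ : ℚ) : ℚ :=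
  ∑ k ∈ E, max k δ * (invRam (E.filter (k < ·)) - invRam (E.filter (k ≤ ·))) + δ * invRam E

theorem meanSlope_mono (E : Finset ℚ) : Monotone (meanSlope E) := by
  intro δ δ' hδ
  refine add_le_add (Finset.sum_le_sum fun k _ => ?_)
    (mul_le_mul_of_nonneg_right hδ (invRam_nonneg E))
  have hsub : E.filter (k < ·) ⊆ E.filter (k ≤ ·) :=
    Finset.monotone_filter_right _ fun _ _ => le_of_lt
  exact mul_le_mul_of_nonneg_right (max_le_max_left k hδ) (sub_nonneg.mpr (invRam_anti hsub))

theorem meanSlope_insert_of_le {a δ : ℚ} {E : Finset ℚ} (ha : ∀ k ∈ E, a < k) (haδ : a ≤ δ) :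
    meanSlope (insert a E) δ = meanSlope E δ := by
  have hlt : (insert a E).filter (a < ·) = E := by
    rw [Finset.filter_insert, if_neg (lt_irrefl a), Finset.filter_true_of_mem ha]
  have hle : (insert a E).filter (a ≤ ·) = insert a E := by
    rw [Finset.filter_insert, if_pos le_rfl, Finset.filter_true_of_mem fun k hk => (ha k hk).le]
  have hsum : ∀ k ∈ E, max k δ * (invRam ((insert a E).filter (k < ·))
      - invRam ((insert a E).filter (k ≤ ·))) =
      max k δ * (invRam (E.filter (k < ·)) - invRam (E.filter (k ≤ ·))) := by
    intro k hk
    rw [Finset.filter_insert, if_neg (ha k hk).not_gt, Finset.filter_insert,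
      if_neg (ha k hk).not_ge]
  rw [meanSlope, meanSlope, Finset.sum_insert fun h => (ha a h).false, hlt, hle, max_eq_right haδ,
    Finset.sum_congr rfl hsum]
  ring

theorem meanSlope_filter_lt (E : Finset ℚ) (δ : ℚ) :
    meanSlope (E.filter (δ < ·)) δ = meanSlope E δ := by
  induction E using Finset.induction_on_min with
  | empty => rw [Finset.filter_empty]
  | insert a E ha ih =>
    by_cases haδ : δ < a
    · rw [Finset.filter_true_of_mem]
      exact (Finset.forall_mem_insert _ _ _).mpr ⟨haδ, fun k hk => haδ.trans (ha k hk)⟩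
    · rw [Finset.filter_insert, if_neg haδ, ih, meanSlope_insert_of_le ha (not_lt.mp haδ)]

theorem meanSlope_of_lcm_den_eq_one {E : Finset ℚ} (hE : E.lcm Rat.den = 1) (δ : ℚ) :
    meanSlope E δ = δ := by
  have invRam_eq_one : ∀ S ⊆ E, invRam S = 1 := fun S hS => by
    have hlcm : S.lcm Rat.den = 1 := Nat.dvd_one.mp (hE ▸ Finset.lcm_mono hS)
    rw [invRam, hlcm, Nat.cast_one, inv_one]
  have hsum : ∀ k ∈ E, max k δ * (invRam (E.filter (k < ·)) - invRam (E.filter (k ≤ ·))) = 0 := by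
    intro k _
    rw [invRam_eq_one _ (Finset.filter_subset _ _), invRam_eq_one _ (Finset.filter_subset _ _),
      sub_self, mul_zero]
  rw [meanSlope, Finset.sum_eq_zero hsum, invRam_eq_one E subset_rfl, zero_add, mul_one]

theorem exists_circle_eq (I : StokesCircle) : ∃ q : ExpFactor, q.circle = I :=
  Quotient.exists_rep I

theorem exponents_trunc (l : ℚ) (I : StokesCircle) :
    (I.trunc l).exponents = I.exponents.filter (l ≤ ·) := by
  induction I using Quotient.inductionOn with
  | h q => exact Finsupp.support_filter _ _

theorem exponents_pos {I : StokesCircle} {k : ℚ} (hk : k ∈ I.exponents) : 0 < k := by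
  induction I using Quotient.inductionOn with
  | h q => exact q.pos k hk

theorem ram_eq (I : StokesCircle) : I.ram = I.exponents.lcm Rat.den := by
  induction I using Quotient.inductionOn with
  | h q => rfl

theorem ram_pos (I : StokesCircle) : 0 < I.ram :=
  I.ram_eq ▸ lcm_den_pos _

theorem den_dvd_ram {I : StokesCircle} {k : ℚ} (hk : k ∈ I.exponents) : k.den ∣ I.ram :=
  I.ram_eq ▸ Finset.dvd_lcm hk

theorem eq_of_exponents_eq_empty {I J : StokesCircle} (hI : I.exponents = ∅)
    (hJ : J.exponents = ∅) : I = J := by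
  induction I, J using Quotient.inductionOn₂ with
  | h q q' =>
    have hcoeff : q.coeff = q'.coeff :=
      (Finsupp.support_eq_empty.mp hI).trans (Finsupp.support_eq_empty.mp hJ).symm
    exact congrArg ExpFactor.circle (ExpFactor.ext hcoeff)

theorem trunc_trunc (l l' : ℚ) (I : StokesCircle) :
    (I.trunc l).trunc l' = I.trunc (max l l') := by
  induction I using Quotient.inductionOn with
  | h q =>
    refine congrArg ExpFactor.circle (ExpFactor.ext (Finsupp.ext fun k => ?_))
    by_cases h1 : l ≤ k <;> by_cases h2 : l' ≤ k <;> simp [ExpFactor.trunc, h1, h2]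

theorem trunc_congr {I : StokesCircle} {l l' : ℚ} (h : ∀ k ∈ I.exponents, l ≤ k ↔ l' ≤ k) :
    I.trunc l = I.trunc l' := by
  induction I using Quotient.inductionOn with
  | h q =>
    refine congrArg ExpFactor.circle (ExpFactor.ext (Finsupp.ext fun k => ?_))
    by_cases hk : q.coeff k = 0
    · simp [ExpFactor.trunc, Finsupp.filter_apply, hk]
    · have := h k (Finsupp.mem_support_iff.mpr hk)
      simp [ExpFactor.trunc, Finsupp.filter_apply, this]

theorem trunc_zero (I : StokesCircle) : I.trunc 0 = I := by
  induction I using Quotient.inductionOn with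
  | h q =>
    refine congrArg ExpFactor.circle (ExpFactor.ext (Finsupp.filter_eq_self_iff _ _ |>.mpr ?_))
    exact fun k hk => (q.pos k (Finsupp.mem_support_iff.mpr hk)).le

theorem trunc_eq_trunc_of_le {I J : StokesCircle} {l l' : ℚ} (hl : l ≤ l')
    (h : I.trunc l = J.trunc l) : I.trunc l' = J.trunc l' := by
  rw [← max_eq_right hl, ← trunc_trunc, ← trunc_trunc, h]

theorem exists_exponent_ge_of_trunc_ne {I J : StokesCircle} {l : ℚ} (h : I.trunc l ≠ J.trunc l) :
    ∃ k ∈ I.exponents ∪ J.exponents, l ≤ k ∧ I.trunc k ≠ J.trunc k := by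
  have hne : ((I.exponents ∪ J.exponents).filter (l ≤ ·)).Nonempty := by
    by_contra! hempty
    rw [Finset.filter_union, Finset.union_eq_empty, ← exponents_trunc, ← exponents_trunc] at hempty
    exact h (eq_of_exponents_eq_empty hempty.1 hempty.2)
  obtain ⟨k, hk, hmin⟩ := Finset.exists_minimal hne
  obtain ⟨hkS, hlk⟩ := Finset.mem_filter.mp hk
  have trunc_eq : ∀ K : StokesCircle, K.exponents ⊆ I.exponents ∪ J.exponents →
      K.trunc l = K.trunc k := fun K hK => trunc_congr fun k' hk' =>
    ⟨fun hl => (le_total k k').elim id fun hle => hmin (Finset.mem_filter.mpr ⟨hK hk', hl⟩) hle,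
      hlk.trans⟩
  refine ⟨k, hkS, hlk, ?_⟩
  rwa [← trunc_eq I Finset.subset_union_left, ← trunc_eq J Finset.subset_union_right]

theorem commonThreshold_le {I J : StokesCircle} {k : ℚ} (hk : 0 < k)
    (hd : k.den ∣ Nat.lcm I.ram J.ram) (h : I.trunc k = J.trunc k) : commonThreshold I J ≤ k := by
  set L := Nat.lcm I.ram J.ram with hL
  have hLpos : (0 : ℚ) < L := by
    exact_mod_cast Nat.lcm_pos I.ram_pos J.ram_pos
  obtain ⟨n, rfl⟩ : ∃ n : ℕ, (n : ℚ) / L = k :=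
    ⟨numer L k, by rw [cast_numer hk.le hd, mul_div_cancel_left₀ _ hLpos.ne']⟩
  have hn : 0 < n := by
    exact_mod_cast (div_pos_iff_of_pos_right hLpos).mp hk
  rw [commonThreshold, ← hL, div_le_div_iff_of_pos_right hLpos, Nat.cast_le]
  exact Nat.sInf_le ⟨hn, h⟩

/-- `δ` is the fission exponent of two Stokes circles: the largest exponent at which they differ,
i.e. the largest `l` for which `⟨τ_l (q)⟩ ≠ ⟨τ_l (q')⟩`. -/
def IsFissionExponent (I J : StokesCircle) (δ : ℚ) : Prop :=
  IsGreatest {l | I.trunc l ≠ J.trunc l} δ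

theorem exists_isFissionExponent {I J : StokesCircle} (hIJ : I ≠ J) :
    ∃ δ, IsFissionExponent I J δ := by
  classical
  set S := (I.exponents ∪ J.exponents).filter fun k => I.trunc k ≠ J.trunc k
  have exists_ge : ∀ l, I.trunc l ≠ J.trunc l → ∃ k ∈ S, l ≤ k := fun l hl => by
    obtain ⟨k, hk, hlk, hne⟩ := exists_exponent_ge_of_trunc_ne hl
    exact ⟨k, Finset.mem_filter.mpr ⟨hk, hne⟩, hlk⟩
  have hSne : S.Nonempty := by
    obtain ⟨k, hk, -⟩ := exists_ge 0 (by rwa [trunc_zero, trunc_zero])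
    exact ⟨k, hk⟩
  refine ⟨S.max' hSne, (Finset.mem_filter.mp (S.max'_mem hSne)).2, fun l hl => ?_⟩
  obtain ⟨k, hk, hlk⟩ := exists_ge l hl
  exact hlk.trans (S.le_max' k hk)

namespace IsFissionExponent

variable {I J K : StokesCircle} {a b c δ : ℚ}

theorem symm (h : IsFissionExponent I J δ) : IsFissionExponent J I δ := by
  simpa only [IsFissionExponent, ne_comm] using h

theorem trunc_eq_iff (h : IsFissionExponent I J δ) {l : ℚ} : I.trunc l = J.trunc l ↔ δ < l :=
  ⟨fun hl => not_le.mp fun hle => h.1 (trunc_eq_trunc_of_le hle hl),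
    fun hlt => not_not.mp fun hne => hlt.not_ge (h.2 hne)⟩

theorem le_max (hIJ : IsFissionExponent I J a) (hJK : IsFissionExponent J K b)
    (hIK : IsFissionExponent I K c) : c ≤ max a b := by
  by_contra! hlt
  obtain ⟨hac, hbc⟩ := max_lt_iff.mp hlt
  exact hIK.1 ((hIJ.trunc_eq_iff.mpr hac).trans (hJK.trunc_eq_iff.mpr hbc))

theorem mem_union (h : IsFissionExponent I J δ) : δ ∈ I.exponents ∪ J.exponents := by
  obtain ⟨k, hk, hδk, hne⟩ := exists_exponent_ge_of_trunc_ne h.1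
  rwa [hδk.antisymm (h.2 hne)]

theorem pos (h : IsFissionExponent I J δ) : 0 < δ :=
  (Finset.mem_union.mp h.mem_union).elim exponents_pos exponents_pos

theorem filter_lt_eq (h : IsFissionExponent I J δ) :
    I.exponents.filter (δ < ·) = J.exponents.filter (δ < ·) := by
  ext k
  simp only [Finset.mem_filter]
  refine and_congr_left fun hk => ?_
  have hexp := congrArg StokesCircle.exponents (h.trunc_eq_iff.mpr hk)
  rw [exponents_trunc, exponents_trunc] at hexp
  simpa using Finset.ext_iff.mp hexp k

theorem meanSlope_eq (h : IsFissionExponent I J δ) :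
    meanSlope I.exponents δ = meanSlope J.exponents δ := by
  rw [← meanSlope_filter_lt, h.filter_lt_eq, meanSlope_filter_lt]

theorem lt_commonThreshold (h : IsFissionExponent I J δ) : δ < commonThreshold I J := by
  have hL : (0 : ℚ) < Nat.lcm I.ram J.ram := by
    exact_mod_cast Nat.lcm_pos I.ram_pos J.ram_pos
  obtain ⟨n, hn⟩ := exists_nat_gt (δ * Nat.lcm I.ram J.ram)
  have hn0 : (0 : ℚ) < n := (mul_pos h.pos hL).trans hn
  refine h.trunc_eq_iff.mp (Nat.sInf_mem (s := {n : ℕ | 0 < n ∧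
    I.trunc ((n : ℚ) / (Nat.lcm I.ram J.ram : ℕ)) =
      J.trunc ((n : ℚ) / (Nat.lcm I.ram J.ram : ℕ))}) ⟨n, ?_, ?_⟩).2
  · exact_mod_cast hn0
  · exact h.trunc_eq_iff.mpr ((lt_div_iff₀ hL).mpr hn)

theorem lt_commonThreshold_iff (h : IsFissionExponent I J δ) {k : ℚ} (hk : k ∈ I.exponents) :
    k < commonThreshold I J ↔ k ≤ δ := by
  have hd : k.den ∣ Nat.lcm I.ram J.ram := (den_dvd_ram hk).trans (Nat.dvd_lcm_left _ _)
  refine ⟨fun hlt => h.2 fun heq => ?_, fun hle => hle.trans_lt h.lt_commonThreshold⟩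
  exact (commonThreshold_le (exponents_pos hk) hd heq).not_gt hlt

theorem exponents_commonPart (h : IsFissionExponent I J δ) :
    (commonPart I J).exponents = I.exponents.filter (δ < ·) := by
  rw [commonPart, exponents_trunc]
  refine Finset.filter_congr fun k hk => ?_
  rw [← not_lt, h.lt_commonThreshold_iff hk, not_le]

theorem diffSlope_eq (h : IsFissionExponent I J δ) :
    diffSlope I J = (insert 0 (I.exponents.filter (· ≤ δ))).max' (Finset.insert_nonempty _ _) := by
  simp only [diffSlope, Finset.filter_congr fun _ hk => h.lt_commonThreshold_iff hk]

theorem diffSlope_le (h : IsFissionExponent I J δ) : diffSlope I J ≤ δ := by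
  rw [h.diffSlope_eq, Finset.max'_le_iff, Finset.forall_mem_insert]
  exact ⟨h.pos.le, fun k hk => (Finset.mem_filter.mp hk).2⟩

theorem diffSlope_eq_iff (h : IsFissionExponent I J δ) : diffSlope I J = δ ↔ δ ∈ I.exponents := by
  rw [h.diffSlope_eq]
  refine ⟨fun heq => ?_, fun hδ => ?_⟩
  · have hmem := Finset.max'_mem _ (Finset.insert_nonempty 0 (I.exponents.filter (· ≤ δ)))
    rw [heq] at hmem
    exact (Finset.mem_filter.mp (Finset.mem_of_mem_insert_of_ne hmem h.pos.ne')).1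
  · rw [← h.diffSlope_eq]
    refine h.diffSlope_le.antisymm (h.diffSlope_eq ▸ Finset.le_max' _ _ ?_)
    exact Finset.mem_insert_of_mem (Finset.mem_filter.mpr ⟨hδ, le_rfl⟩)

theorem diffSlope_le_diffSlope_iff (h : IsFissionExponent I J δ) :
    diffSlope J I ≤ diffSlope I J ↔ δ ∈ I.exponents := by
  rw [← h.diffSlope_eq_iff]
  refine ⟨fun hle => ?_, fun heq => heq ▸ h.symm.diffSlope_le⟩
  rcases Finset.mem_union.mp h.mem_union with hI | hJ
  · exact h.diffSlope_eq_iff.mpr hI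
  · exact h.diffSlope_le.antisymm (h.symm.diffSlope_eq_iff.mpr hJ ▸ hle)

theorem cast_edgeFormula (h : IsFissionExponent I J δ) (hδ : δ ∈ I.exponents) :
    (edgeFormula I J : ℚ) = I.ram * J.ram * (meanSlope J.exponents δ - 1) := by
  set E := (commonPart I J).exponents
  have hEI : E = I.exponents.filter (δ < ·) := h.exponents_commonPart
  have hEJ : E = J.exponents.filter (δ < ·) := hEI.trans h.filter_lt_eq
  have hgcd : ∀ S ⊆ E, (gcdOf J.ram S : ℚ) = J.ram * invRam S := fun S hS =>
    cast_gcdOf J.ram_pos.ne' fun k hk =>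
      den_dvd_ram (Finset.mem_of_mem_filter k (hEJ ▸ hS hk))
  have hnumer : ∀ k ∈ I.exponents, (numer I.ram k : ℚ) = I.ram * k := fun k hk =>
    cast_numer (exponents_pos hk).le (den_dvd_ram hk)
  have hsum : ∀ k ∈ E, (numer I.ram k : ℚ) *
      ((gcdOf J.ram (E.filter (k < ·)) : ℚ) - (gcdOf J.ram (E.filter (k ≤ ·)) : ℚ)) =
      I.ram * J.ram * (max k δ * (invRam (E.filter (k < ·)) - invRam (E.filter (k ≤ ·)))) := by
    intro k hk
    obtain ⟨hkI, hδk⟩ := Finset.mem_filter.mp (hEI ▸ hk)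
    rw [hgcd _ (Finset.filter_subset _ _), hgcd _ (Finset.filter_subset _ _), hnumer k hkI,
      max_eq_left hδk.le]
    ring
  rw [edgeFormula, h.diffSlope_eq_iff.mpr hδ, ← meanSlope_filter_lt, ← hEJ, meanSlope]
  push_cast
  rw [Finset.sum_congr rfl hsum, ← Finset.mul_sum, hgcd E subset_rfl, hnumer δ hδ]
  ring

theorem cast_edgeMult (h : IsFissionExponent I J δ) :
    (edgeMult I J : ℚ) = I.ram * J.ram * (meanSlope J.exponents δ - 1) := by
  by_cases hI : δ ∈ I.exponents
  · rw [edgeMult, if_pos (h.diffSlope_le_diffSlope_iff.mpr hI), h.cast_edgeFormula hI]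
  · have hJ : δ ∈ J.exponents := (Finset.mem_union.mp h.mem_union).resolve_left hI
    rw [edgeMult, if_neg (h.diffSlope_le_diffSlope_iff.not.mpr hI), h.symm.cast_edgeFormula hJ,
      h.meanSlope_eq, mul_comm (J.ram : ℚ)]

theorem edgeMult_nonpos_iff (h : IsFissionExponent I J δ) :
    edgeMult I J ≤ 0 ↔ meanSlope J.exponents δ ≤ 1 := by
  have hI : (0 : ℚ) < I.ram := by exact_mod_cast I.ram_pos
  have hJ : (0 : ℚ) < J.ram := by exact_mod_cast J.ram_pos
  rw [← Int.cast_nonpos (R := ℚ), h.cast_edgeMult, mul_nonpos_iff_pos_imp_nonpos]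
  simp [hI, hJ]

theorem cast_edgeMult_of_ram_eq_one (h : IsFissionExponent I J δ) (hI : I.ram = 1)
    (hJ : J.ram = 1) : (edgeMult I J : ℚ) = δ - 1 := by
  rw [h.cast_edgeMult, meanSlope_of_lcm_den_eq_one (J.ram_eq ▸ hJ), hI, hJ, Nat.cast_one, one_mul,
    one_mul]

end IsFissionExponent

theorem edgeMult_nonpos_trans {I J K : StokesCircle} (hIJ : I ≠ J) (hJK : J ≠ K) (hIK : I ≠ K)
    (h1 : edgeMult I J ≤ 0) (h2 : edgeMult J K ≤ 0) : edgeMult I K ≤ 0 := by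
  obtain ⟨a, ha⟩ := exists_isFissionExponent hIJ
  obtain ⟨b, hb⟩ := exists_isFissionExponent hJK
  obtain ⟨c, hc⟩ := exists_isFissionExponent hIK
  rw [ha.edgeMult_nonpos_iff, ← ha.meanSlope_eq] at h1
  rw [hb.edgeMult_nonpos_iff] at h2
  rw [hc.edgeMult_nonpos_iff]
  rcases le_max_iff.mp (ha.le_max hb hc) with hca | hcb
  · exact hc.meanSlope_eq ▸ (meanSlope_mono _ hca).trans h1
  · exact (meanSlope_mono _ hcb).trans h2

theorem loopMult_of_ram_eq_one {I : StokesCircle} (hI : I.ram = 1) : loopMult I = 0 := by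
  simp [loopMult, hI, gcdOf]

end StokesCircle


namespace Diagram

variable {N : Type*} {Γ : Diagram N} {k : ℕ}

theorem IsSimplyLaced.exists_isCompletePartite [Finite N] (h : Γ.IsSimplyLaced)
    (htrans : ∀ i j k, Γ.B i j = 0 → Γ.B j k = 0 → Γ.B i k = 0) :
    ∃ k : ℕ, Γ.IsCompletePartite k := by
  let nonadjacent : Setoid N :=
    { r := fun i j => Γ.B i j = 0
      iseqv := ⟨h.1.2, fun {i j} hij => (Γ.symm j i).trans hij, fun {i j k} => htrans i j k⟩ }
  obtain ⟨k, ⟨e⟩⟩ := Finite.exists_equiv_fin (Quotient nonadjacent)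
  have part_eq_iff : ∀ i j, e ⟦i⟧ = e ⟦j⟧ ↔ Γ.B i j = 0 := fun i j =>
    e.injective.eq_iff.trans Quotient.eq
  refine ⟨k, fun i => e ⟦i⟧, e.surjective.comp Quotient.mk_surjective,
    fun i j hij => (part_eq_iff i j).mp hij, fun i j hij => ?_⟩
  have hij0 : Γ.B i j ≠ 0 := (part_eq_iff i j).not.mp hij
  exact (h.2 i j fun heq => hij (heq ▸ rfl)).resolve_left hij0

theorem IsCompletePartite.one_le [Nonempty N] (h : Γ.IsCompletePartite k) : 1 ≤ k := by
  obtain ⟨f, -⟩ := h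
  exact Fin.pos (f (Classical.arbitrary N))

theorem IsCompletePartite.isSimplyLaced (h : Γ.IsCompletePartite k) : Γ.IsSimplyLaced := by
  obtain ⟨f, -, h0, h1⟩ := h
  have h01 : ∀ i j, Γ.B i j = 0 ∨ Γ.B i j = 1 := fun i j =>
    (em (f i = f j)).imp (h0 i j) (h1 i j)
  refine ⟨⟨fun i j => ?_, fun i => h0 i i rfl⟩, fun i j _ => h01 i j⟩
  rcases h01 i j with h | h <;> simp [h]

theorem IsCoreDiagramOf.exists_isCompletePartite {Θ : IrregularClass} (hΘ : Γ.IsCoreDiagramOf Θ)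
    (h : Γ.IsSimplyLaced) : ∃ k : ℕ, Γ.IsCompletePartite k := by
  obtain ⟨e, -, he⟩ := hΘ
  have : Finite N := Finite.of_equiv _ e.symm
  have circle_ne : ∀ {i j}, i ≠ j → (e i).1 ≠ (e j).1 := fun hij heq =>
    hij (e.injective (Subtype.ext heq))
  refine h.exists_isCompletePartite fun i j k hij hjk => ?_
  rcases eq_or_ne i j with rfl | hne_ij
  · exact hjk
  rcases eq_or_ne j k with rfl | hne_jk
  · exact hij
  rcases eq_or_ne i k with rfl | hne_ik
  · exact h.1.2 i
  rw [he i j hne_ij] at hij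
  rw [he j k hne_jk] at hjk
  refine le_antisymm ?_ (h.1.1 i k)
  rw [he i k hne_ik]
  exact StokesCircle.edgeMult_nonpos_trans (circle_ne hne_ij) (circle_ne hne_jk)
    (circle_ne hne_ik) hij.le hjk.le

end Diagram

namespace ExpFactor

variable {q q' : ExpFactor}

theorem den_eq_one_of_ram_eq_one (hq : q.ram = 1) {k : ℚ} (hk : k ∈ q.exponents) : k.den = 1 :=
  Nat.dvd_one.mp (hq ▸ Finset.dvd_lcm hk)

theorem circle_eq_iff (hq : q.ram = 1) : q.circle = q'.circle ↔ q = q' := by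
  refine ⟨fun h => ?_, congrArg circle⟩
  obtain ⟨m, hm⟩ := Quotient.exact h
  ext k
  rw [hm k]
  by_cases hk : q.coeff k = 0
  · rw [hk, mul_zero]
  · have hden : k.den = 1 := den_eq_one_of_ram_eq_one hq (Finsupp.mem_support_iff.mpr hk)
    have hexp : Complex.exp (2 * Real.pi * Complex.I * m * k) = 1 := by
      rw [Complex.exp_eq_one_iff]
      refine ⟨m * k.num, ?_⟩
      have hnum : (k : ℂ) = k.num := by rw [Rat.cast_def, hden, Nat.cast_one, div_one]
      rw [hnum]
      push_cast
      ring
    rw [hexp, one_mul]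

theorem ram_trunc_eq_one (hq : q.ram = 1) (l : ℚ) : (q.trunc l).ram = 1 := by
  refine Nat.dvd_one.mp (hq ▸ Finset.lcm_mono ?_)
  rw [exponents, trunc, Finsupp.support_filter]
  exact Finset.filter_subset _ _

theorem circle_trunc_eq_iff (hq : q.ram = 1) (l : ℚ) :
    q.circle.trunc l = q'.circle.trunc l ↔ ∀ k, l ≤ k → q.coeff k = q'.coeff k := by
  change (q.trunc l).circle = (q'.trunc l).circle ↔ _
  rw [circle_eq_iff (ram_trunc_eq_one hq l), ExpFactor.ext_iff, DFunLike.ext_iff]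
  refine forall_congr' fun k => ?_
  by_cases hk : l ≤ k <;> simp [trunc, hk]

theorem isFissionExponent_circle (hq : q.ram = 1) {δ : ℚ} (hδ : q.coeff δ ≠ q'.coeff δ)
    (h : ∀ k, δ < k → q.coeff k = q'.coeff k) :
    StokesCircle.IsFissionExponent q.circle q'.circle δ := by
  refine ⟨fun heq => hδ ((circle_trunc_eq_iff hq δ).mp heq δ le_rfl), fun l hl => ?_⟩
  by_contra! hlt
  exact hl ((circle_trunc_eq_iff hq l).mpr fun k hk => h k (hlt.trans_le hk))

/-- The exponential factor `q` as a polynomial in `z`. It only has this meaning if `ram q = 1`;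
in general `z ^ k` is replaced with `z ^ (numerator of k)`. -/
def toPolynomial (q : ExpFactor) : ℂ[X] :=
  ∑ k ∈ q.exponents, Polynomial.monomial k.num.natAbs (q.coeff k)

end ExpFactor

theorem aeval_single_monomial (R n : ℕ) (c : ℂ) :
    Polynomial.aeval (HahnSeries.single (-(R : ℤ)) 1 : ℂ⸨X⸩) (Polynomial.monomial n c) =
      HahnSeries.single (-(R * n : ℤ)) c := by
  have hc : algebraMap ℂ ℂ⸨X⸩ c = HahnSeries.single 0 c :=
    (HahnSeries.algebraMap_apply' (Γ := ℤ) c).trans (HahnSeries.ofPowerSeries_C c)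
  rw [Polynomial.aeval_monomial, hc, HahnSeries.single_pow, HahnSeries.single_mul_single, one_pow,
    mul_one, zero_add, nsmul_eq_mul, mul_neg, mul_comm (n : ℤ)]

theorem ExpFactor.toLaurent_eq_aeval {q : ExpFactor} (hq : q.ram = 1) (R : ℕ) :
    q.toLaurent R = Polynomial.aeval (HahnSeries.single (-(R : ℤ)) 1 : ℂ⸨X⸩) q.toPolynomial := by
  rw [toLaurent, toPolynomial, map_sum]
  refine Finset.sum_congr rfl fun k hk => ?_
  have hnum : ((k.num.natAbs : ℤ) : ℚ) = k := by
    rw [Int.natAbs_of_nonneg (Rat.num_nonneg.mpr (q.pos k hk).le),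
      Rat.coe_int_num_of_den_eq_one (den_eq_one_of_ram_eq_one hq hk)]
  have hRk : (R : ℚ) * k = ((R * k.num.natAbs : ℤ) : ℚ) := by
    rw [Int.cast_mul, hnum, Int.cast_natCast]
  rw [aeval_single_monomial, hRk, Rat.num_intCast]

theorem eulerD_single (m : ℤ) (c : ℂ) :
    eulerD (HahnSeries.single m c) = HahnSeries.single m (m * c) := by
  simp [eulerD, LaurentSeries.derivative]

theorem eulerD_add (f g : ℂ⸨X⸩) : eulerD (f + g) = eulerD f + eulerD g := by
  rw [eulerD, map_add, mul_add, eulerD, eulerD]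

theorem eulerD_zero : eulerD 0 = 0 := by
  rw [eulerD, map_zero, mul_zero]

theorem eulerD_one : eulerD 1 = 0 := by
  simpa using eulerD_single 0 1

theorem eulerD_aeval (R : ℕ) (p : ℂ[X]) :
    eulerD (Polynomial.aeval (HahnSeries.single (-(R : ℤ)) 1 : ℂ⸨X⸩) p) =
      -(HahnSeries.single (-(R : ℤ)) (R : ℂ) *
        Polynomial.aeval (HahnSeries.single (-(R : ℤ)) 1 : ℂ⸨X⸩) (Polynomial.derivative p)) := by
  induction p using Polynomial.induction_on' with
  | add p p' hp hp' =>
    rw [map_add, eulerD_add, hp, hp', Polynomial.derivative_add, map_add, mul_add, neg_add]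
  | monomial n c =>
    rw [Polynomial.derivative_monomial, aeval_single_monomial, aeval_single_monomial, eulerD_single,
      HahnSeries.single_mul_single, ← HahnSeries.single_neg]
    rcases n with _ | n
    · simp
    · congr 1 <;> push_cast <;> ring_nf

namespace AlgConnection

/-- The diagonal connection `d/dz + diag (A_1, …, A_n)` on the trivial bundle of rank `n`. -/
def diagonal {n : ℕ} (A : Fin n → ℂ[X]) : AlgConnection where
  E := Fin n → ℂ[X]
  nabla :=
    { toFun := fun s i => Polynomial.derivative (s i) + A i * s i
      map_zero' := by ext1; simp
      map_add' := fun s t => by ext1; simp; ring }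
  leibniz f s := by
    ext1
    simp
    ring

theorem connMatrix_diagonal {n : ℕ} (A : Fin n → ℂ[X]) :
    (diagonal A).connMatrix (Pi.basisFun ℂ[X] (Fin n)) = Matrix.diagonal A := by
  ext1 i j
  change Polynomial.derivative (Pi.basisFun ℂ[X] (Fin n) j i)
    + A i * Pi.basisFun ℂ[X] (Fin n) j i = _
  rcases eq_or_ne i j with rfl | h
  · simp
  · simp [h]

end AlgConnection

theorem isFormalSolution_diagonal {n R : ℕ} (hR : 0 < R) {q : Fin n → ExpFactor}
    (hq : ∀ i, (q i).ram = 1) :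
    IsFormalSolution (Matrix.diagonal fun i => -Polynomial.derivative (q i).toPolynomial)
      R 1 0 q where
  pos := hR
  ram_dvd i := hq i ▸ one_dvd R
  isUnit := isUnit_one
  commute _ _ _ := rfl
  eqn := by
    have map_one_eulerD : (1 : Matrix (Fin n) (Fin n) ℂ⸨X⸩).map eulerD = 0 := by
      ext1 i j
      rw [Matrix.map_apply, Matrix.one_apply]
      split_ifs <;> simp [eulerD_zero, eulerD_one]
    rw [map_one_eulerD, Matrix.map_zero _ (map_zero _), zero_add, zero_add, one_mul, mul_one,
      Matrix.diagonal_map (map_zero _)]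
    ext1 i j
    rw [Matrix.smul_apply, smul_eq_mul]
    rcases eq_or_ne i j with rfl | h
    · rw [Matrix.diagonal_apply_eq, Matrix.diagonal_apply_eq, (q i).toLaurent_eq_aeval (hq i),
        eulerD_aeval, map_neg]
      exact (mul_neg (α := ℂ⸨X⸩) _ _).symm
    · rw [Matrix.diagonal_apply_ne _ h, Matrix.diagonal_apply_ne _ h, mul_zero]

theorem IrregularClass.exists_enumeration (Θ : IrregularClass) :
    ∃ (n : ℕ) (q : Fin n → ExpFactor), ∀ I, Nat.card {a // (q a).circle = I} = Θ I := by
  have : Finite (Σ I, Fin (Θ I)) := by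
    refine Set.finite_univ_iff.mp ((Θ.support.sigma fun _ => Finset.univ).finite_toSet.subset ?_)
    rintro ⟨I, m⟩ -
    simpa using m.pos.ne'
  obtain ⟨n, ⟨e⟩⟩ := Finite.exists_equiv_fin (Σ I, Fin (Θ I))
  choose rep circle_rep using StokesCircle.exists_circle_eq
  refine ⟨n, fun a => rep (e.symm a).1, fun I => ?_⟩
  calc Nat.card {a : Fin n // (rep (e.symm a).1).circle = I}
      = Nat.card {x : Σ I, Fin (Θ I) // x.1 = I} :=
        Nat.card_congr (e.symm.subtypeEquiv fun a => by rw [circle_rep])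
    _ = Nat.card (Fin (Θ I)) := Nat.card_congr (Equiv.sigmaSubtype I)
    _ = Θ I := Nat.card_fin _

theorem IrregularClass.IsUntwisted.exists_hasIrregularClass {Θ : IrregularClass}
    (hΘ : Θ.IsUntwisted) : ∃ V : AlgConnection, V.HasIrregularClass Θ := by
  obtain ⟨n, q, hq⟩ := Θ.exists_enumeration
  have ram_eq_one : ∀ a, (q a).ram = 1 := fun a => by
    refine hΘ (q a).circle (Finsupp.mem_support_iff.mpr ?_)
    rw [← hq, Nat.card_ne_zero]
    exact ⟨⟨a, rfl⟩, inferInstance⟩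
  refine ⟨AlgConnection.diagonal fun a => -Polynomial.derivative (q a).toPolynomial, n,
    Pi.basisFun ℂ[X] (Fin n), 1, 1, 0, q, ?_, fun p => ?_⟩
  · rw [AlgConnection.connMatrix_diagonal]
    exact isFormalSolution_diagonal one_pos ram_eq_one
  · simp_rw [← hq, ExpFactor.circle_eq_iff (ram_eq_one _)]

theorem Diagram.isFissionGraph_of_injective {N : Type*} [Finite N] {Γ : Diagram N}
    {c : N → StokesCircle} (hc : Function.Injective c) (hram : ∀ i, (c i).ram = 1)
    (hloop : ∀ i, Γ.B i i = 0) (hedge : ∀ i j, i ≠ j → Γ.B i j = (c i).edgeMult (c j)) :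
    Γ.IsFissionGraph := by
  classical
  let Θ : IrregularClass := Finsupp.indicator (Set.finite_range c).toFinset fun _ _ => 1
  have mem_support_iff : ∀ I, I ∈ Set.range c ↔ I ∈ Θ.support := fun I => by
    simp [Θ, Finsupp.indicator_apply]
  have hΘ : Θ.IsUntwisted := fun I hI => by
    obtain ⟨i, rfl⟩ := (mem_support_iff I).mpr hI
    exact hram i
  obtain ⟨V, hV⟩ := hΘ.exists_hasIrregularClass
  let e : N ≃ {I : StokesCircle // I ∈ Θ.support} :=
    (Equiv.ofInjective c hc).trans (Equiv.subtypeEquivRight mem_support_iff)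
  refine ⟨V, Θ, hV, hΘ, e, fun i => ?_, hedge⟩
  exact (hloop i).trans (StokesCircle.loopMult_of_ram_eq_one (hram i)).symm

namespace ExpFactor

/-- The exponential factor `a z ^ 2 + b z`, used to realize a vertex in the part labelled `a`. -/
def quadratic (a b : ℂ) : ExpFactor where
  coeff := Finsupp.single 2 a + Finsupp.single 1 b
  pos k hk := by
    classical
    rcases Finset.mem_union.mp (Finsupp.support_add hk) with h | h <;>
      rw [Finset.mem_singleton.mp (Finsupp.support_single_subset h)] <;> norm_num

variable {a b a' b' : ℂ}

theorem quadratic_coeff (k : ℚ) :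
    (quadratic a b).coeff k = if k = 2 then a else if k = 1 then b else 0 := by
  by_cases h2 : k = 2
  · simp [quadratic, h2]
  · simp [quadratic, Finsupp.single_apply, h2, eq_comm]

theorem quadratic_ram : (quadratic a b).ram = 1 := by
  refine Nat.dvd_one.mp (Finset.lcm_dvd fun k hk => ?_)
  have hk21 : k = 2 ∨ k = 1 := by
    by_contra! h
    exact Finsupp.mem_support_iff.mp hk (by rw [quadratic_coeff, if_neg h.1, if_neg h.2])
  rcases hk21 with rfl | rfl <;> simp

theorem isFissionExponent_quadratic_of_ne (h : a ≠ a') :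
    StokesCircle.IsFissionExponent (quadratic a b).circle (quadratic a' b').circle 2 := by
  refine isFissionExponent_circle quadratic_ram (by simpa [quadratic_coeff] using h) fun k hk => ?_
  have hk1 : (1 : ℚ) < k := one_lt_two.trans hk
  simp [quadratic_coeff, hk.ne', hk1.ne']

theorem isFissionExponent_quadratic_of_eq (h : b ≠ b') :
    StokesCircle.IsFissionExponent (quadratic a b).circle (quadratic a b').circle 1 := by
  refine isFissionExponent_circle quadratic_ram (by simpa [quadratic_coeff] using h) fun k hk => ?_
  simp [quadratic_coeff, hk.ne']

theorem edgeMult_quadratic_of_ne (h : a ≠ a') :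
    StokesCircle.edgeMult (quadratic a b).circle (quadratic a' b').circle = 1 := by
  have hcast := (isFissionExponent_quadratic_of_ne (b := b) (b' := b')
    h).cast_edgeMult_of_ram_eq_one quadratic_ram quadratic_ram
  norm_num at hcast
  exact_mod_cast hcast

theorem edgeMult_quadratic_of_eq (h : b ≠ b') :
    StokesCircle.edgeMult (quadratic a b).circle (quadratic a b').circle = 0 := by
  have hcast := (isFissionExponent_quadratic_of_eq (a := a) h).cast_edgeMult_of_ram_eq_one
    quadratic_ram quadratic_ram
  rw [sub_self] at hcast
  exact_mod_cast hcast

end ExpFactor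

theorem Diagram.IsCompletePartite.isFissionGraph {N : Type*} [Finite N] {Γ : Diagram N} {k : ℕ}
    (h : Γ.IsCompletePartite k) : Γ.IsFissionGraph := by
  obtain ⟨f, -, h0, h1⟩ := h
  obtain ⟨n, ⟨σ⟩⟩ := Finite.exists_equiv_fin N
  let a : N → ℂ := fun i => ((f i : ℕ) : ℂ)
  let b : N → ℂ := fun i => ((σ i : ℕ) : ℂ)
  have ha : ∀ {i j}, a i = a j → f i = f j := fun h => Fin.ext (Nat.cast_injective h)
  have hb : Function.Injective b := fun i j h => σ.injective (Fin.ext (Nat.cast_injective h))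
  refine isFissionGraph_of_injective (c := fun i => (ExpFactor.quadratic (a i) (b i)).circle)
    (fun i j hij => ?_) (fun i => ExpFactor.quadratic_ram) (fun i => h0 i i rfl) fun i j hij => ?_
  · have hcoeff := congrArg (fun q => q.coeff 1)
      ((ExpFactor.circle_eq_iff ExpFactor.quadratic_ram).mp hij)
    exact hb (by simpa [ExpFactor.quadratic_coeff] using hcoeff)
  · by_cases hf : f i = f j
    · have haij : a i = a j := by simp only [a, hf]
      rw [h0 i j hf, haij, ExpFactor.edgeMult_quadratic_of_eq (hb.ne hij)]
    · rw [h1 i j hf, ExpFactor.edgeMult_quadratic_of_ne fun h => hf (ha h)]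

end

theorem proposition4p5_general {N : Type*} [Finite N] [Nonempty N] (Γ : Diagram N) :
    (∀ Θ : IrregularClass, Γ.IsCoreDiagramOf Θ → Γ.IsSimplyLaced →
      Γ.IsFissionGraph ∧ ∃ k : ℕ, 1 ≤ k ∧ Γ.IsCompletePartite k) ∧
    ((Γ.IsFissionGraph ∧ Γ.IsSimplyLaced) ↔ ∃ k : ℕ, 1 ≤ k ∧ Γ.IsCompletePartite k) := by
  refine ⟨fun Θ hΘ h => ?_, ?_, ?_⟩
  · obtain ⟨k, hk⟩ := hΘ.exists_isCompletePartite h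
    exact ⟨hk.isFissionGraph, k, hk.one_le, hk⟩
  · rintro ⟨⟨_, Θ, _, _, hΘ⟩, h⟩
    obtain ⟨k, hk⟩ := hΘ.exists_isCompletePartite h
    exact ⟨k, hk.one_le, hk⟩
  · rintro ⟨k, -, hk⟩
    exact ⟨hk.isFissionGraph, hk.isSimplyLaced⟩

theorem proposition4p5 {N : Type*} [Finite N] [Nonempty N] (Γ : Diagram N) :
    (Γ.IsNonabelianHodge → Γ.IsSimplyLaced →
      Γ.IsFissionGraph ∧ ∃ k : ℕ, 1 ≤ k ∧ Γ.IsCompletePartite k) ∧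
    ((Γ.IsFissionGraph ∧ Γ.IsSimplyLaced) ↔ ∃ k : ℕ, 1 ≤ k ∧ Γ.IsCompletePartite k) :=
  (proposition4p5_general Γ).imp_left fun h ⟨_, Θ, _, hΘ⟩ => h Θ hΘ
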